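/- Let $d\ge 1$, $q\ge 1$, $\Sigma=[q]=\{1,\dots,q\}$. A $d$-dimensional array of size $(n_1,\dots,n_d)$ over the $q$-symbol alphabet is a family of symbols $a_{\mathbf i}\in\Sigma$ indexed by $\mathbf i\in[n_1]\times\dots\times[n_d]$; it has order $n$ if $n_1=\dots=n_d=n$. An array $A$ contains an array $A'$ if $A'$ is obtained from $A$ by repeatedly (zero or more times) choosing $j\in[d]$ and $\ell\in[n_j]$ (where $(n_1,\dots,n_d)$ is the current size) and deleting all symbols whose $j$-th coordinate is $\ell$, which gives an array whose $j$-th side length is smaller by one. The array $A$ is $k$-universal if it contains every $d$-dimensional array over $\Sigma$ of size $(m_1,\dots,m_d)$ with $m_j\le k$ for all $j$. **Theorem.** Let $d,q\ge 2$ be fixed integers and let $\varepsilon>0$ be real. For each $k$ let $n_k$ be $$(1+\varepsilon)\,\frac{k}{e}\,q^{k^{d-1}/d}$$ rounded up or down to an integer (that is, $n_k$ is a non-negative integer at distance less than $1$ from this number). Then the probability that a uniformly random $d$-dimensional array of order $n_k$ over the $q$-symbol alphabet is $k$-universal tends to $1$ as $k\to\infty$. -/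

import Mathlib

/-- A `d`-dimensional array of size `s = (s 0, …, s (d-1))` over the `q`-symbol alphabet `Fin q`. -/
abbrev DArray (d q : ℕ) (s : Fin d → ℕ) : Type :=
  ((j : Fin d) → Fin (s j)) → Fin q

namespace DArray

/-- The coordinate restriction operation: delete all the symbols of `A` whose `j`-th coordinate
is `l`. In the resulting array the `j`-th coordinates `≥ l` are shifted by one. -/
def restrict {d q : ℕ} {s : Fin d → ℕ} (A : DArray d q s) (j : Fin d) (l : Fin (s j)) :
    DArray d q (Function.update s j (s j - 1)) :=
  fun x => A fun i =>
    ⟨if i = j ∧ (l : ℕ) ≤ (x i : ℕ) then (x i : ℕ) + 1 else (x i : ℕ), by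
      have hx := (x i).isLt
      by_cases h : i = j
      · subst h
        have hl := l.isLt
        simp only [Function.update_self] at hx
        split_ifs <;> omega
      · simpa [h] using hx⟩

/-- `A.Contains B`: the array `B` can be obtained from `A` by iteratively applying (zero or more)
coordinate restriction operations. -/
inductive Contains {d q : ℕ} : {s t : Fin d → ℕ} → DArray d q s → DArray d q t → Prop
  | refl {s : Fin d → ℕ} (A : DArray d q s) : Contains A A
  | step {s t : Fin d → ℕ} (A : DArray d q s) (B : DArray d q t) (j : Fin d) (l : Fin (s j)) :
      Contains (A.restrict j l) B → Contains A B

/-- `A` is `k`-universal: it contains every array (over the same alphabet) all of whose side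
lengths are at most `k`. -/
def IsUniversal {d q : ℕ} {s : Fin d → ℕ} (k : ℕ) (A : DArray d q s) : Prop :=
  ∀ t : Fin d → ℕ, (∀ j, t j ≤ k) → ∀ B : DArray d q t, A.Contains B

end DArray

/-! Fix a pattern of side k and a set W of N coordinates. A copy on a grid T_1 × … × T_d of
k-subsets of W prescribes k^d symbols, so the expected number of copies is μ = C(N,k)^d / q^(k^d).
Taking N close to c (k/e) q^(k^(d-1)/d) with c slightly above 1, Stirling makes μ exponentially
large in k (`le_choose_pow_div`). Only q^(k^d) patterns compete in the union bound, so a failure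
probability of exp(-μ/2) per pattern suffices.

That Janson-type bound is `card_avoiding_le_exp`. It needs, for every grid S, the sum of q^(-|T \
S|) over the other grids T meeting S to be at most 1/4. If T_j and S_j share a_j elements, then |T \
S| = k^d - ∏ a_j. For d ≥ 2, `prod_le_sum_sq_div` bounds the product by a sum over directions, so
the correlation sum is at most (1 + `overlapSum`)^d - 1, and the one-dimensional `overlapSum` tends
to 0. -/

/-! ### A Janson-type bound for avoiding cylinders. -/

open Finset in
/-- The functions that agree with `v` on `C`. -/
def cylinder {ι α : Type*} [Fintype ι] [DecidableEq ι] [Fintype α] [DecidableEq α]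
    (C : Finset ι) (v : ι → α) : Finset (ι → α) :=
  univ.filter fun A => ∀ c ∈ C, A c = v c

section Cylinder

open Finset

variable {ι α I : Type*} [Fintype ι] [DecidableEq ι] [Fintype α] [DecidableEq α]

theorem mem_cylinder {C : Finset ι} {v A : ι → α} :
    A ∈ cylinder C v ↔ ∀ c ∈ C, A c = v c := by
  simp [cylinder]

theorem card_agree_outside (C : Finset ι) (A₀ : ι → α) :
    #{A : ι → α | ∀ c ∉ C, A c = A₀ c} = Fintype.card α ^ #C := by
  have h : ({A : ι → α | ∀ c ∉ C, A c = A₀ c} : Finset (ι → α)) =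
      Fintype.piFinset fun c => if c ∈ C then univ else {A₀ c} := by
    ext A
    simp only [mem_filter, mem_univ, true_and, Fintype.mem_piFinset]
    refine forall_congr' fun c => ?_
    by_cases hc : c ∈ C <;> simp [hc]
  rw [h, Fintype.card_piFinset]
  simp [apply_ite Finset.card]

/-- A cylinder over `C` is independent of every event that does not depend on the coordinates
in `C`. -/
theorem card_inter_cylinder (C : Finset ι) (v : ι → α) (E : Finset (ι → α))
    (hE : ∀ A A' : ι → α, (∀ c ∉ C, A c = A' c) → A ∈ E → A' ∈ E) :
    #(cylinder C v ∩ E) * Fintype.card α ^ #C = #E := by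
  -- Overwriting the coordinates in `C` by `v` maps `E` to the intersection, with all fibres of size
  -- |α|^|C|.
  have key := card_eq_sum_card_fiberwise (s := E) (t := cylinder C v ∩ E)
    (f := fun A c => if c ∈ C then v c else A c) (by
      intro A hA
      simp only [coe_inter, Set.mem_inter_iff, mem_coe, mem_cylinder]
      refine ⟨fun c hc => by simp [hc], hE A _ (fun c hc => by simp [hc]) hA⟩)
  rw [key, ← smul_eq_mul, ← sum_const]
  refine sum_congr rfl fun A₀ hA₀ => ?_
  rw [mem_inter, mem_cylinder] at hA₀
  rw [← card_agree_outside C A₀]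
  congr 1
  ext A
  simp only [mem_filter, mem_univ, true_and]
  constructor
  · intro h
    refine ⟨hE A₀ A (fun c hc => (h c hc).symm) hA₀.2, ?_⟩
    funext c
    by_cases hc : c ∈ C
    · simp [hc, hA₀.1 c hc]
    · simp [hc, h c hc]
  · rintro ⟨-, h⟩ c hc
    simpa [hc] using congrFun h c

/-- The functions that lie in none of the cylinders indexed by `S`. -/
def avoiding (C : I → Finset ι) (v : I → ι → α) (S : Finset I) : Finset (ι → α) :=
  univ.filter fun A => ∀ i ∈ S, A ∉ cylinder (C i) (v i)

theorem mem_avoiding {C : I → Finset ι} {v : I → ι → α} {S : Finset I} {A : ι → α} :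
    A ∈ avoiding C v S ↔ ∀ i ∈ S, A ∉ cylinder (C i) (v i) := by
  simp [avoiding]

theorem avoiding_anti (C : I → Finset ι) (v : I → ι → α) {S T : Finset I} (h : S ⊆ T) :
    avoiding C v T ⊆ avoiding C v S := fun _ hA =>
  mem_avoiding.2 fun i hi => mem_avoiding.1 hA i (h hi)

theorem card_cylinder_inter_avoiding (C : I → Finset ι) (v : I → ι → α) (S : Finset I)
    (D : Finset ι) (u : ι → α) (hD : ∀ j ∈ S, Disjoint (C j) D) :
    #(cylinder D u ∩ avoiding C v S) * Fintype.card α ^ #D = #(avoiding C v S) := by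
  refine card_inter_cylinder D u _ fun A A' h hA => ?_
  rw [mem_avoiding] at hA ⊢
  intro i hi hA'
  refine hA i hi (mem_cylinder.2 fun c hc => ?_)
  rw [h c (fun hcD => disjoint_left.1 (hD i hi) hc hcD), mem_cylinder.1 hA' c hc]

/-- Union bound for discarding the constraints in `p`: a function that satisfies the remaining ones
but not all of `S` lies in a cylinder with index in `p`. -/
theorem card_avoiding_sub_le (C : I → Finset ι) (v : I → ι → α) (S : Finset I) (p : I → Prop)
    [DecidablePred p] (E : Finset (ι → α)) :
    (#(E ∩ avoiding C v (S.filter fun j => ¬ p j)) : ℝ) ≤ #(E ∩ avoiding C v S) +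
      ∑ j ∈ S.filter p,
        (#(E ∩ (cylinder (C j) (v j) ∩ avoiding C v (S.filter fun j => ¬ p j))) : ℝ) := by
  have h : E ∩ avoiding C v (S.filter fun j => ¬ p j) ⊆ (E ∩ avoiding C v S) ∪
      (S.filter p).biUnion fun j =>
        E ∩ (cylinder (C j) (v j) ∩ avoiding C v (S.filter fun j => ¬ p j)) := by
    intro A hA
    rw [mem_inter] at hA
    by_cases hS : A ∈ avoiding C v S
    · exact mem_union_left _ (mem_inter.2 ⟨hA.1, hS⟩)
    · refine mem_union_right _ ?_
      simp only [mem_avoiding, not_forall, not_not] at hS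
      obtain ⟨j, hj, hjA⟩ := hS
      refine mem_biUnion.2 ⟨j, ?_, mem_inter.2 ⟨hA.1, mem_inter.2 ⟨hjA, hA.2⟩⟩⟩
      rw [mem_filter]
      refine ⟨hj, ?_⟩
      by_contra hp
      exact mem_avoiding.1 hA.2 j (mem_filter.2 ⟨hj, hp⟩) hjA
  have h2 := (card_le_card h).trans ((card_union_le _ _).trans
    (Nat.add_le_add_left card_biUnion_le _))
  exact_mod_cast h2

/-- Two cylinders meet inside a single cylinder over the union of their supports, which is
independent of the constraints in `S`. There is only an inequality because the prescriptions may
conflict. -/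
theorem card_cylinder_inter_cylinder_inter_avoiding_le [Nonempty α] (C : I → Finset ι)
    (v : I → ι → α) (S : Finset I) (i j : I)
    (hi : ∀ l ∈ S, Disjoint (C l) (C i)) (hj : ∀ l ∈ S, Disjoint (C l) (C j)) :
    (#(cylinder (C i) (v i) ∩ (cylinder (C j) (v j) ∩ avoiding C v S)) : ℝ) ≤
      ((Fintype.card α : ℝ) ^ #(C i))⁻¹ * ((Fintype.card α : ℝ) ^ #(C j \ C i))⁻¹ *
        #(avoiding C v S) := by
  have hα : (0 : ℝ) < Fintype.card α := by exact_mod_cast Fintype.card_pos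
  set u : ι → α := fun c => if c ∈ C i then v i c else v j c
  have hsub : cylinder (C i) (v i) ∩ (cylinder (C j) (v j) ∩ avoiding C v S) ⊆
      cylinder (C i ∪ (C j \ C i)) u ∩ avoiding C v S := by
    intro A hA
    simp only [mem_inter, mem_cylinder] at hA ⊢
    refine ⟨fun c hc => ?_, hA.2.2⟩
    by_cases h : c ∈ C i
    · simp [u, h, hA.1 c h]
    · simp only [mem_union, h, mem_sdiff, not_false_eq_true, and_true, false_or] at hc
      simp [u, h, hA.2.1 c hc]
  have hc := card_cylinder_inter_avoiding C v S (C i ∪ (C j \ C i)) u fun l hl =>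
    disjoint_union_right.2 ⟨hi l hl, (hj l hl).mono_right sdiff_subset⟩
  rw [card_union_of_disjoint disjoint_sdiff] at hc
  rw [← hc]
  have := card_le_card hsub
  push_cast
  rw [pow_add]
  have h1 : ((Fintype.card α : ℝ) ^ #(C i))⁻¹ * ((Fintype.card α : ℝ) ^ #(C j \ C i))⁻¹ *
      (#(cylinder (C i ∪ (C j \ C i)) u ∩ avoiding C v S) *
        ((Fintype.card α : ℝ) ^ #(C i) * (Fintype.card α : ℝ) ^ #(C j \ C i))) =
      #(cylinder (C i ∪ (C j \ C i)) u ∩ avoiding C v S) := by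
    field_simp
  rw [h1]
  exact_mod_cast this

variable [DecidableEq I]

/-- The lower bound of the Lovász local lemma for cylinders. -/
theorem card_cylinder_inter_avoiding_le [Nonempty α] (C : I → Finset ι) (v : I → ι → α)
    (U : Finset I)
    (hU : ∀ i ∈ U, ∑ j ∈ U with j ≠ i ∧ ¬ Disjoint (C j) (C i),
      ((Fintype.card α : ℝ) ^ #(C j))⁻¹ ≤ 1 / 4) (S : Finset I) :
    S ⊆ U → ∀ i ∈ U, i ∉ S → (#(cylinder (C i) (v i) ∩ avoiding C v S) : ℝ) ≤
      2 * ((Fintype.card α : ℝ) ^ #(C i))⁻¹ * #(avoiding C v S) := by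
  induction S using Finset.strongInduction with
  | H S ih =>
    intro hSU i hi hiS
    have hα : (0 : ℝ) < Fintype.card α := by exact_mod_cast Fintype.card_pos
    set p : I → ℝ := fun i => ((Fintype.card α : ℝ) ^ #(C i))⁻¹ with hp
    have hp0 : ∀ i, 0 ≤ p i := fun i => by positivity
    set S₂ := S.filter fun j => ¬ ¬ Disjoint (C j) (C i) with hS₂
    have hind : (#(cylinder (C i) (v i) ∩ avoiding C v S₂) : ℝ) = p i * #(avoiding C v S₂) := by
      rw [← card_cylinder_inter_avoiding C v S₂ (C i) (v i) (by
        intro j hj; simpa using (mem_filter.1 hj).2)]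
      push_cast
      rw [hp]
      field_simp
    have h1 : (#(cylinder (C i) (v i) ∩ avoiding C v S) : ℝ) ≤
        #(cylinder (C i) (v i) ∩ avoiding C v S₂) := by
      exact_mod_cast card_le_card (inter_subset_inter_left (avoiding_anti C v (filter_subset _ _)))
    have h2 := card_avoiding_sub_le C v S (fun j => ¬ Disjoint (C j) (C i)) univ
    simp only [univ_inter] at h2
    rw [← hS₂] at h2
    have h3 : ∑ j ∈ S with ¬ Disjoint (C j) (C i),
        (#(cylinder (C j) (v j) ∩ avoiding C v S₂) : ℝ) ≤
        ∑ j ∈ S with ¬ Disjoint (C j) (C i), 2 * p j * #(avoiding C v S₂) := by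
      refine sum_le_sum fun j hj => ?_
      rw [mem_filter] at hj
      refine ih S₂ ?_ ((filter_subset _ _).trans hSU) j (hSU hj.1) ?_
      · exact filter_ssubset.2 ⟨j, hj.1, by simpa using hj.2⟩
      · simp [hS₂, hj.2]
    have h4 : ∑ j ∈ S with ¬ Disjoint (C j) (C i), p j ≤ 1 / 4 := by
      refine (sum_le_sum_of_subset_of_nonneg ?_ fun _ _ _ => hp0 _).trans (hU i hi)
      intro j hj
      rw [mem_filter] at hj ⊢
      exact ⟨hSU hj.1, fun h => hiS (h ▸ hj.1), hj.2⟩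
    rw [← sum_mul, ← mul_sum] at h3
    have h5 : (0 : ℝ) ≤ #(avoiding C v S₂) := by positivity
    have h6 := mul_le_mul_of_nonneg_right h4 h5
    have h7 : (#(avoiding C v S₂) : ℝ) ≤ 2 * #(avoiding C v S) := by nlinarith
    calc _ ≤ p i * #(avoiding C v S₂) := h1.trans hind.le
      _ ≤ p i * (2 * #(avoiding C v S)) := mul_le_mul_of_nonneg_left h7 (hp0 i)
      _ = _ := by ring

/-- By the local lemma estimate, the neighbours of `i` together hit at most half of the functions
avoiding the rest, so restoring their constraints costs at most a factor 2. -/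
theorem card_avoiding_filter_le [Nonempty α] (C : I → Finset ι) (v : I → ι → α)
    (U : Finset I)
    (hU : ∀ i ∈ U, ∑ j ∈ U with j ≠ i ∧ ¬ Disjoint (C j) (C i),
      ((Fintype.card α : ℝ) ^ #(C j))⁻¹ ≤ 1 / 4) (S : Finset I) (hS : S ⊆ U)
    (i : I) (hi : i ∈ U) (hiS : i ∉ S) :
    (#(avoiding C v (S.filter fun j => ¬ ¬ Disjoint (C j) (C i))) : ℝ) ≤
      2 * #(avoiding C v S) := by
  set p : I → ℝ := fun i => ((Fintype.card α : ℝ) ^ #(C i))⁻¹ with hp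
  have hp0 : ∀ i, 0 ≤ p i := fun i => by positivity
  set S₂ := S.filter fun j => ¬ ¬ Disjoint (C j) (C i) with hS₂
  have h2 := card_avoiding_sub_le C v S (fun j => ¬ Disjoint (C j) (C i)) univ
  simp only [univ_inter] at h2
  rw [← hS₂] at h2
  have h3 : ∑ j ∈ S with ¬ Disjoint (C j) (C i),
      (#(cylinder (C j) (v j) ∩ avoiding C v S₂) : ℝ) ≤
      ∑ j ∈ S with ¬ Disjoint (C j) (C i), 2 * p j * #(avoiding C v S₂) := by
    refine sum_le_sum fun j hj => ?_
    rw [mem_filter] at hj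
    exact card_cylinder_inter_avoiding_le C v U hU S₂ ((filter_subset _ _).trans hS) j (hS hj.1)
      (by simp [hS₂, hj.2])
  have h4 : ∑ j ∈ S with ¬ Disjoint (C j) (C i), p j ≤ 1 / 4 := by
    refine (sum_le_sum_of_subset_of_nonneg ?_ fun _ _ _ => hp0 _).trans (hU i hi)
    intro j hj
    rw [mem_filter] at hj ⊢
    exact ⟨hS hj.1, fun h => hiS (h ▸ hj.1), hj.2⟩
  rw [← sum_mul, ← mul_sum] at h3
  have h5 : (0 : ℝ) ≤ #(avoiding C v S₂) := by positivity
  have h6 := mul_le_mul_of_nonneg_right h4 h5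
  nlinarith

/-- If every cylinder is only weakly correlated with the others, then the number of functions that
avoid all of them is exponentially small in the expected number of cylinders. -/
theorem card_avoiding_le_exp [Nonempty α] (C : I → Finset ι) (v : I → ι → α) (U : Finset I)
    (hU : ∀ i ∈ U, ∑ j ∈ U with j ≠ i ∧ ¬ Disjoint (C j) (C i),
      ((Fintype.card α : ℝ) ^ #(C j \ C i))⁻¹ ≤ 1 / 4) :
    (#(avoiding C v U) : ℝ) ≤
      Real.exp (-(∑ i ∈ U, ((Fintype.card α : ℝ) ^ #(C i))⁻¹) / 2) *
        (Fintype.card α : ℝ) ^ Fintype.card ι := by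
  have hα1 : (1 : ℝ) ≤ Fintype.card α := by exact_mod_cast Fintype.card_pos
  have hα : (0 : ℝ) < Fintype.card α := by linarith
  set p : I → ℝ := fun i => ((Fintype.card α : ℝ) ^ #(C i))⁻¹ with hp
  have hp0 : ∀ i, 0 ≤ p i := fun i => by positivity
  have hU' : ∀ i ∈ U, ∑ j ∈ U with j ≠ i ∧ ¬ Disjoint (C j) (C i), p j ≤ 1 / 4 := by
    intro i hi
    refine (sum_le_sum fun j _ => ?_).trans (hU i hi)
    exact inv_anti₀ (by positivity) (pow_le_pow_right₀ hα1 (card_le_card sdiff_subset))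
  suffices h : ∀ S ⊆ U, (#(avoiding C v S) : ℝ) ≤
      Real.exp (-(∑ i ∈ S, p i) / 2) * (Fintype.card α : ℝ) ^ Fintype.card ι from h U subset_rfl
  intro S
  induction S using Finset.induction_on with
  | empty =>
    intro _
    have := card_le_univ (avoiding C v (∅ : Finset I))
    rw [Fintype.card_fun] at this
    simp only [sum_empty, neg_zero, zero_div, Real.exp_zero, one_mul]
    exact_mod_cast this
  | insert i S hiS ih =>
    intro hS
    have hSU : S ⊆ U := (subset_insert _ _).trans hS
    have hi : i ∈ U := hS (mem_insert_self _ _)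
    have ih := ih hSU
    set S₂ := S.filter fun j => ¬ ¬ Disjoint (C j) (C i) with hS₂
    have hS₂i : ∀ j ∈ S₂, Disjoint (C j) (C i) := fun j hj => by simpa using (mem_filter.1 hj).2
    have hind : (#(cylinder (C i) (v i) ∩ avoiding C v S₂) : ℝ) = p i * #(avoiding C v S₂) := by
      rw [← card_cylinder_inter_avoiding C v S₂ (C i) (v i) hS₂i]
      push_cast
      rw [hp]
      field_simp
    have h2 := card_avoiding_sub_le C v S (fun j => ¬ Disjoint (C j) (C i))
      (cylinder (C i) (v i))
    rw [← hS₂, hind] at h2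
    have h3 : ∑ j ∈ S with ¬ Disjoint (C j) (C i),
        (#(cylinder (C i) (v i) ∩ (cylinder (C j) (v j) ∩ avoiding C v S₂)) : ℝ) ≤
        ∑ j ∈ S with ¬ Disjoint (C j) (C i), ((Fintype.card α : ℝ) ^ #(C j \ C i))⁻¹ *
          (2 * p i * #(avoiding C v S₂)) := by
      refine sum_le_sum fun j hj => ?_
      rw [mem_filter] at hj
      -- Neighbours of `j` are dropped as well, making the pair of cylinders independent of `S₃`;
      -- returning to `S₂` costs the factor 2.
      set S₃ := S₂.filter fun l => ¬ ¬ Disjoint (C l) (C j) with hS₃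
      have h31 : (#(cylinder (C i) (v i) ∩ (cylinder (C j) (v j) ∩ avoiding C v S₂)) : ℝ) ≤
          #(cylinder (C i) (v i) ∩ (cylinder (C j) (v j) ∩ avoiding C v S₃)) := by
        exact_mod_cast card_le_card (inter_subset_inter_left (inter_subset_inter_left
          (avoiding_anti C v (filter_subset _ _))))
      have h32 := card_cylinder_inter_cylinder_inter_avoiding_le C v S₃ i j
        (fun l hl => hS₂i l (filter_subset _ _ hl))
        (fun l hl => by simpa using (mem_filter.1 hl).2)
      have h33 := card_avoiding_filter_le C v U hU' S₂ ((filter_subset _ _).trans hSU) j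
        (hSU hj.1) (by simp [hS₂, hj.2])
      rw [← hS₃] at h33
      refine h31.trans (h32.trans ?_)
      calc _ ≤ p i * ((Fintype.card α : ℝ) ^ #(C j \ C i))⁻¹ * (2 * #(avoiding C v S₂)) :=
            mul_le_mul_of_nonneg_left h33 (by positivity)
        _ = _ := by ring
    have h4 : ∑ j ∈ S with ¬ Disjoint (C j) (C i), ((Fintype.card α : ℝ) ^ #(C j \ C i))⁻¹
        ≤ 1 / 4 := by
      refine (sum_le_sum_of_subset_of_nonneg ?_ fun _ _ _ => by positivity).trans (hU i hi)
      intro j hj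
      rw [mem_filter] at hj ⊢
      exact ⟨hSU hj.1, fun h => hiS (h ▸ hj.1), hj.2⟩
    rw [← sum_mul] at h3
    have h5 : (0 : ℝ) ≤ 2 * p i * #(avoiding C v S₂) :=
      mul_nonneg (mul_nonneg zero_le_two (hp0 i)) (Nat.cast_nonneg _)
    have h6 := mul_le_mul_of_nonneg_right h4 h5
    have h7 : p i * #(avoiding C v S) ≤ p i * #(avoiding C v S₂) :=
      mul_le_mul_of_nonneg_left
        (by exact_mod_cast card_le_card (avoiding_anti C v (filter_subset _ _))) (hp0 i)
    have h8 : (#(avoiding C v S) : ℝ) = #(cylinder (C i) (v i) ∩ avoiding C v S) +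
        #(avoiding C v (insert i S)) := by
      have hd : avoiding C v (insert i S) = avoiding C v S \ cylinder (C i) (v i) := by
        ext A
        simp [mem_avoiding, and_comm]
      rw [hd, inter_comm]
      exact_mod_cast (card_inter_add_card_sdiff _ _).symm
    -- Of the main term p_i |`avoiding C v S₂`|, the pair terms remove at most 2 p_i · 1/4, leaving
    -- half.
    have h9 : (#(avoiding C v (insert i S)) : ℝ) ≤ (1 - p i / 2) * #(avoiding C v S) := by
      nlinarith
    have h10 : 1 - p i / 2 ≤ Real.exp (-(p i / 2)) := by
      have := Real.add_one_le_exp (-(p i / 2))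
      linarith
    rw [sum_insert hiS]
    calc _ ≤ Real.exp (-(p i / 2)) * #(avoiding C v S) :=
          h9.trans (mul_le_mul_of_nonneg_right h10 (Nat.cast_nonneg _))
      _ ≤ Real.exp (-(p i / 2)) *
          (Real.exp (-(∑ i ∈ S, p i) / 2) * (Fintype.card α : ℝ) ^ Fintype.card ι) :=
          mul_le_mul_of_nonneg_left ih (Real.exp_pos _).le
      _ = _ := by
          rw [← mul_assoc, ← Real.exp_add]
          congr 2
          ring

end Cylinder

/-! ### Containment by strictly increasing maps. -/

namespace DArray

/-- Induction on the total side length: delete a coordinate missed by some `f j` and shift the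
larger values of `f j` down by one. If nothing is missed, every `f j` is the identity. -/
theorem contains_of_strictMono {d q : ℕ} {t : Fin d → ℕ} (B : DArray d q t) (m : ℕ) :
    ∀ {s : Fin d → ℕ} (A : DArray d q s), ∑ j, s j = m →
      ∀ f : ∀ j, Fin (t j) → Fin (s j), (∀ j, StrictMono (f j)) →
        (∀ x, B x = A fun j => f j (x j)) → A.Contains B := by
  induction m with
  | zero =>
    intro s A hm f hf h
    have hs : ∀ j, s j = 0 := by simpa using hm
    have ht : t = s := by
      funext j
      have := Fintype.card_le_of_injective _ (hf j).injective
      simp only [Fintype.card_fin, hs] at this ⊢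
      omega
    subst ht
    have hBA : B = A := by
      funext x
      rw [h]
      congr 1
      funext j
      exact absurd (x j).isLt (by simp [hs])
    rw [hBA]
    exact .refl A
  | succ m ih =>
    intro s A hm f hf h
    have hle : ∀ j, t j ≤ s j := fun j => by
      simpa using Fintype.card_le_of_injective _ (hf j).injective
    by_cases hst : ∀ j, s j = t j
    · obtain rfl : t = s := funext fun j => (hst j).symm
      have hid : ∀ j, f j = id := fun j =>
        (hf j).range_inj strictMono_id |>.1 (by
          rw [Set.range_id]
          exact (Finite.surjective_of_injective (hf j).injective).range_eq)
      have hBA : B = A := by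
        funext x
        rw [h]
        simp [hid]
      rw [hBA]
      exact .refl A
    · push Not at hst
      obtain ⟨j, hj⟩ := hst
      have hlt : t j < s j := lt_of_le_of_ne (hle j) hj.symm
      obtain ⟨l, hl⟩ : ∃ l, ∀ x, f j x ≠ l := by
        by_contra! hsurj
        have := Fintype.card_le_of_surjective (f j) hsurj
        simp only [Fintype.card_fin] at this
        omega
      have hl' : ∀ x, (f j x : ℕ) ≠ l := fun x hx => hl x (Fin.ext hx)
      refine .step A B j l (ih (A.restrict j l) ?_
        (fun i x => ⟨if h : i = j ∧ (l : ℕ) < f i x then (f i x : ℕ) - 1 else f i x, ?_⟩) ?_ ?_)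
      · rw [Finset.sum_update_of_mem (Finset.mem_univ j)]
        have := Finset.add_sum_erase Finset.univ s (Finset.mem_univ j)
        rw [Finset.erase_eq] at this
        omega
      · have := (f i x).isLt
        by_cases hij : i = j
        · subst hij
          have := hl' x
          have := l.isLt
          simp only [Function.update_self, true_and]
          split_ifs <;> omega
        · simp [hij]
      · intro i x y hxy
        have hlt : (f i x : ℕ) < f i y := hf i hxy
        rw [Fin.lt_def]
        by_cases hij : i = j
        · subst hij
          have := hl' x
          have := hl' y
          simp only [true_and]
          split_ifs <;> omega
        · simpa [hij] using hlt
      · intro x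
        rw [h, restrict]
        congr 1
        funext i
        apply Fin.ext
        by_cases hij : i = j
        · subst hij
          have := hl' (x i)
          simp only [true_and]
          split_ifs <;> omega
        · simp [hij]

/-- Containment of all arrays with side lengths exactly `k` already gives universality. -/
theorem isUniversal_of_forall {d q k : ℕ} (hq : 0 < q) {s : Fin d → ℕ} (A : DArray d q s)
    (h : ∀ M : DArray d q fun _ => k, ∃ f : ∀ j, Fin k → Fin (s j), (∀ j, StrictMono (f j)) ∧
      ∀ x, M x = A fun j => f j (x j)) : A.IsUniversal k := by
  intro t ht B
  -- `B` is padded to a full cube; the padding symbol is immaterial.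
  obtain ⟨f, hf, hM⟩ := h fun x =>
    if hx : ∀ j, (x j : ℕ) < t j then B fun j => ⟨x j, hx j⟩ else ⟨0, hq⟩
  refine contains_of_strictMono B _ A rfl (fun j x => f j (Fin.castLE (ht j) x))
    (fun j => (hf j).comp (Fin.strictMono_castLE (ht j))) fun x => ?_
  rw [← hM fun j => Fin.castLE (ht j) (x j)]
  simp

end DArray

/-! ### Union bound over patterns. -/

open Finset in
/-- The symbols that the cells of the subarray on `T` must carry for it to be a copy of `M`. -/
noncomputable def prescription {d q n k : ℕ} (hq : 0 < q) (M : DArray d q fun _ => k)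
    (T : Fin d → Finset (Fin n)) : DArray d q fun _ => n :=
  open Classical in
  if h : ∀ j, #(T j) = k then
    Function.extend (fun x j => (T j).orderEmbOfFin (h j) (x j)) M fun _ => ⟨0, hq⟩
  else fun _ => ⟨0, hq⟩

open Finset in
theorem card_not_isUniversal_le {d q n k : ℕ} (hq : 0 < q) (W : Finset (Fin n)) (b : ℝ)
    (hb : ∀ v : (Fin d → Finset (Fin n)) → DArray d q fun _ => n,
      (#(avoiding (fun T : Fin d → Finset (Fin n) => Fintype.piFinset T) v
        (Fintype.piFinset fun _ => powersetCard k W)) : ℝ) ≤ b)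
    [DecidablePred fun A : DArray d q fun _ => n => ¬ A.IsUniversal k] :
    (#{A : DArray d q fun _ => n | ¬ A.IsUniversal k} : ℝ) ≤ (q : ℝ) ^ k ^ d * b := by
  have hsub : ({A : DArray d q fun _ => n | ¬ A.IsUniversal k} : Finset _) ⊆
      (univ : Finset (DArray d q fun _ => k)).biUnion fun M =>
        avoiding (fun T : Fin d → Finset (Fin n) => Fintype.piFinset T) (prescription hq M)
          (Fintype.piFinset fun _ => powersetCard k W) := by
    intro A hA
    rw [mem_filter] at hA
    by_contra hcon
    refine hA.2 (DArray.isUniversal_of_forall hq A fun M => ?_)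
    simp only [mem_biUnion, mem_univ, true_and, not_exists, mem_avoiding, not_forall,
      not_not] at hcon
    obtain ⟨T, hT, hTA⟩ := hcon M
    have hcard : ∀ j, #(T j) = k := fun j =>
      (mem_powersetCard.1 (Fintype.mem_piFinset.1 hT j)).2
    refine ⟨fun j => (T j).orderEmbOfFin (hcard j),
      fun j => OrderEmbedding.strictMono _, fun x => ?_⟩
    rw [mem_cylinder] at hTA
    rw [hTA _ (Fintype.mem_piFinset.2 fun j => orderEmbOfFin_mem _ _ _), prescription,
      dif_pos hcard, Function.Injective.extend_apply]
    intro x y hxy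
    funext j
    exact ((T j).orderEmbOfFin (hcard j)).injective (congrFun hxy j)
  have h1 : (#{A : DArray d q fun _ => n | ¬ A.IsUniversal k} : ℝ) ≤
      ∑ M : DArray d q fun _ => k,
        (#(avoiding (fun T : Fin d → Finset (Fin n) => Fintype.piFinset T) (prescription hq M)
          (Fintype.piFinset fun _ => powersetCard k W)) : ℝ) := by
    exact_mod_cast (card_le_card hsub).trans card_biUnion_le
  refine h1.trans ((sum_le_sum fun M _ => hb _).trans ?_)
  rw [sum_const, nsmul_eq_mul, card_univ]
  simp

/-! ### Correlations between overlapping grids. -/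

open Finset in
-- Since 0 ≤ x_j ≤ 1 and d ≥ 2, x_j ≤ x_j^(2/d); then AM-GM applies to the squares.
theorem prod_le_sum_sq_div {d : ℕ} (hd : 2 ≤ d) (x : Fin d → ℝ) (h0 : ∀ j, 0 ≤ x j)
    (h1 : ∀ j, x j ≤ 1) : ∏ j, x j ≤ (∑ j, x j ^ 2) / d := by
  have hd' : (2 : ℝ) ≤ d := by exact_mod_cast hd
  have hd0 : (0 : ℝ) < d := by linarith
  have h := Real.geom_mean_le_arith_mean_weighted (univ : Finset (Fin d)) (fun _ => 1 / (d : ℝ))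
    (fun j => x j ^ 2) (fun _ _ => by positivity) (by simp [hd0.ne']) (fun j _ => sq_nonneg _)
  rw [← mul_sum, one_div, inv_mul_eq_div] at h
  refine le_trans (prod_le_prod (fun j _ => h0 j) fun j _ => ?_) h
  rw [← Real.rpow_natCast, ← Real.rpow_mul (h0 j)]
  conv_lhs => rw [← Real.rpow_one (x j)]
  refine Real.rpow_le_rpow_of_exponent_ge' (h0 j) (h1 j) (by positivity) ?_
  rw [← div_eq_mul_inv, div_le_one hd0]
  exact_mod_cast hd

open Finset in
theorem card_filter_card_inter_le {β : Type*} [DecidableEq β] {k a : ℕ} {S W : Finset β}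
    (hS : S ∈ powersetCard k W) :
    #{T ∈ powersetCard k W | #(T ∩ S) = a} ≤ k.choose a * (#W - k).choose (k - a) := by
  rw [mem_powersetCard] at hS
  have hc : #(powersetCard a S ×ˢ powersetCard (k - a) (W \ S)) =
      k.choose a * (#W - k).choose (k - a) := by
    rw [card_product, card_powersetCard, card_powersetCard, card_sdiff_of_subset hS.1, hS.2]
  rw [← hc]
  refine card_le_card_of_injOn (fun T => (T ∩ S, T \ S)) ?_ ?_
  · intro T hT
    simp only [coe_filter, Set.mem_ofPred_eq, mem_powersetCard] at hT
    simp only [coe_product, Set.mem_prod, mem_coe, mem_powersetCard]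
    refine ⟨⟨inter_subset_right, hT.2⟩, sdiff_subset_sdiff hT.1.1 subset_rfl, ?_⟩
    have := card_inter_add_card_sdiff T S
    omega
  · intro T _ T' _ h
    simp only [Prod.mk.injEq] at h
    rw [← sdiff_union_inter T S, ← sdiff_union_inter T' S, h.1, h.2]

/-- The weight of an overlap of size `a` in one direction. -/
noncomputable def overlapWeight (d q k a : ℕ) : ℝ :=
  (q : ℝ) ^ ((k : ℝ) ^ (d - 1) / d / k * ((a : ℝ) ^ 2 - (k : ℝ) ^ 2))

theorem overlapWeight_nonneg (d q k a : ℕ) : 0 ≤ overlapWeight d q k a := by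
  unfold overlapWeight; positivity

theorem overlapWeight_self (d q k : ℕ) : overlapWeight d q k k = 1 := by
  simp [overlapWeight]

/-- The total weight of the proper non-empty overlaps in one direction. -/
noncomputable def overlapSum (d q k N : ℕ) : ℝ :=
  ∑ a ∈ Finset.Ioo 0 k, (k.choose a * (N - k).choose (k - a) : ℕ) * overlapWeight d q k a

theorem overlapSum_nonneg (d q k N : ℕ) : 0 ≤ overlapSum d q k N :=
  Finset.sum_nonneg fun _ _ => mul_nonneg (Nat.cast_nonneg _) (overlapWeight_nonneg _ _ _ _)

open Finset in
-- Applying `prod_le_sum_sq_div` to the ratios a_j/k splits the exponent k^d - ∏ a_j over the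
-- directions.
theorem inv_pow_card_sdiff_le {d q k n : ℕ} (hd : 2 ≤ d) (hq : 1 ≤ q) (hk : 0 < k)
    (S T : Fin d → Finset (Fin n)) (hT : ∀ j, #(T j) = k) :
    ((q : ℝ) ^ #(Fintype.piFinset T \ Fintype.piFinset S))⁻¹ ≤
      ∏ j, overlapWeight d q k #(T j ∩ S j) := by
  have hq' : (1 : ℝ) ≤ q := by exact_mod_cast hq
  have hq0 : (0 : ℝ) < q := by linarith
  have hk' : (0 : ℝ) < k := by exact_mod_cast hk
  have hd0 : (0 : ℝ) < d := by exact_mod_cast (by omega : 0 < d)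
  have hcard : (#(Fintype.piFinset T \ Fintype.piFinset S) : ℝ) =
      (k : ℝ) ^ d - ∏ j, (#(T j ∩ S j) : ℝ) := by
    have h1 := card_inter_add_card_sdiff (Fintype.piFinset T) (Fintype.piFinset S)
    have h2 : Fintype.piFinset T ∩ Fintype.piFinset S = Fintype.piFinset fun j => T j ∩ S j := by
      ext c
      simp [Fintype.mem_piFinset, forall_and]
    rw [h2, Fintype.card_piFinset, Fintype.card_piFinset, prod_congr rfl fun j _ => hT j] at h1
    simp only [prod_const, card_univ, Fintype.card_fin] at h1
    rw [eq_sub_iff_add_eq']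
    exact_mod_cast h1
  unfold overlapWeight
  rw [← Real.rpow_sum_of_pos hq0, ← Real.rpow_natCast, ← Real.rpow_neg hq0.le]
  refine Real.rpow_le_rpow_of_exponent_le hq' ?_
  rw [hcard, ← mul_sum, sum_sub_distrib]
  have h := prod_le_sum_sq_div hd (fun j => (#(T j ∩ S j) : ℝ) / k) (fun j => by positivity)
    (fun j => by
      rw [div_le_one hk', ← hT j]
      exact_mod_cast card_le_card inter_subset_left)
  simp only [prod_div_distrib, div_pow, prod_const, card_univ, Fintype.card_fin,
    ← sum_div] at h
  rw [div_le_iff₀ (by positivity)] at h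
  simp only [sum_const, card_univ, Fintype.card_fin, nsmul_eq_mul]
  obtain ⟨e, rfl⟩ : ∃ e, d = e + 1 := ⟨d - 1, by omega⟩
  simp only [Nat.add_sub_cancel] at h ⊢
  have h3 : (k : ℝ) ^ e / ((e + 1 : ℕ) : ℝ) / k *
      (∑ j, (#(T j ∩ S j) : ℝ) ^ 2 - ((e + 1 : ℕ) : ℝ) * (k : ℝ) ^ 2) =
      (∑ j, (#(T j ∩ S j) : ℝ) ^ 2) / (k : ℝ) ^ 2 / ((e + 1 : ℕ) : ℝ) * (k : ℝ) ^ (e + 1) -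
        (k : ℝ) ^ (e + 1) := by
    field_simp
    ring
  rw [h3]
  linarith

open Finset in
theorem sum_overlapWeight_le {d q k n : ℕ} {W S : Finset (Fin n)}
    (hS : S ∈ powersetCard k W) :
    ∑ T ∈ powersetCard k W with (T ∩ S).Nonempty, overlapWeight d q k #(T ∩ S) ≤
      1 + overlapSum d q k #W := by
  have hSk := (mem_powersetCard.1 hS).2
  set P := (powersetCard k W).filter fun T => (T ∩ S).Nonempty with hP
  have h1 : ∑ T ∈ P with T ≠ S, overlapWeight d q k #(T ∩ S) ≤ overlapSum d q k #W := by
    rw [← sum_fiberwise_of_maps_to (s := P.filter fun T => T ≠ S) (t := Ioo 0 k)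
      (g := fun T => #(T ∩ S))]
    · refine sum_le_sum fun a _ => ?_
      rw [sum_congr rfl fun T hT => by rw [(mem_filter.1 hT).2], sum_const, nsmul_eq_mul]
      refine mul_le_mul_of_nonneg_right ?_ (overlapWeight_nonneg _ _ _ _)
      refine Nat.cast_le.2 ((card_le_card ?_).trans (card_filter_card_inter_le hS))
      intro T hT
      simp only [hP, mem_filter] at hT ⊢
      exact ⟨hT.1.1.1, hT.2⟩
    · intro T hT
      simp only [hP, mem_filter, mem_powersetCard] at hT
      rw [mem_Ioo]
      refine ⟨card_pos.2 hT.1.2, lt_of_le_of_ne ?_ fun h => hT.2 ?_⟩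
      · exact (card_le_card inter_subset_right).trans hSk.le
      · have hTS : T ∩ S = S := eq_of_subset_of_card_le inter_subset_right (by omega)
        exact (eq_of_subset_of_card_le (inter_eq_right.1 hTS) (by omega)).symm
  have h2 : ∑ T ∈ P with ¬ T ≠ S, overlapWeight d q k #(T ∩ S) ≤ 1 := by
    calc _ ≤ ∑ T ∈ {S}, overlapWeight d q k #(T ∩ S) :=
          sum_le_sum_of_subset_of_nonneg (fun T hT => by simpa using (mem_filter.1 hT).2)
            fun _ _ _ => overlapWeight_nonneg _ _ _ _
      _ = 1 := by rw [sum_singleton, inter_self, hSk, overlapWeight_self]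
  rw [← sum_filter_add_sum_filter_not P fun T => T ≠ S]
  linarith

open Finset in
-- Intersecting grids intersect in every direction, so the weighted sum factorises. Each factor has
-- a 1 for T_j = S_j; the subtracted 1 is the term T = S.
theorem sum_correlation_le {d q k n : ℕ} (hd : 2 ≤ d) (hq : 1 ≤ q) (hk : 0 < k)
    (W : Finset (Fin n)) (S : Fin d → Finset (Fin n))
    (hS : S ∈ Fintype.piFinset fun _ : Fin d => powersetCard k W) :
    ∑ T ∈ (Fintype.piFinset fun _ : Fin d => powersetCard k W) with
      T ≠ S ∧ ¬ Disjoint (Fintype.piFinset T) (Fintype.piFinset S),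
      ((q : ℝ) ^ #(Fintype.piFinset T \ Fintype.piFinset S))⁻¹ ≤
    (1 + overlapSum d q k #W) ^ d - 1 := by
  have hS' := Fintype.mem_piFinset.1 hS
  set P : Fin d → Finset (Finset (Fin n)) := fun j =>
    (powersetCard k W).filter fun T => (T ∩ S j).Nonempty with hP
  have hSP : S ∈ Fintype.piFinset P := by
    refine Fintype.mem_piFinset.2 fun j => mem_filter.2 ⟨hS' j, ?_⟩
    rw [inter_self, ← card_pos, (mem_powersetCard.1 (hS' j)).2]
    exact hk
  have h1 : ∑ T ∈ (Fintype.piFinset fun _ : Fin d => powersetCard k W) with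
      T ≠ S ∧ ¬ Disjoint (Fintype.piFinset T) (Fintype.piFinset S),
      ((q : ℝ) ^ #(Fintype.piFinset T \ Fintype.piFinset S))⁻¹ ≤
      ∑ T ∈ (Fintype.piFinset P).erase S, ∏ j, overlapWeight d q k #(T j ∩ S j) := by
    refine (sum_le_sum fun T hT => inv_pow_card_sdiff_le hd hq hk S T fun j => ?_).trans
      (sum_le_sum_of_subset_of_nonneg ?_ fun T _ _ => prod_nonneg fun j _ =>
        overlapWeight_nonneg _ _ _ _)
    · exact (mem_powersetCard.1 (Fintype.mem_piFinset.1 (mem_filter.1 hT).1 j)).2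
    · intro T hT
      rw [mem_filter, Fintype.mem_piFinset] at hT
      refine mem_erase.2 ⟨hT.2.1, Fintype.mem_piFinset.2 fun j => mem_filter.2 ⟨hT.1 j, ?_⟩⟩
      obtain ⟨c, hcT, hcS⟩ := not_disjoint_iff.1 hT.2.2
      exact ⟨c j, mem_inter.2
        ⟨Fintype.mem_piFinset.1 hcT j, Fintype.mem_piFinset.1 hcS j⟩⟩
  have h2 : ∑ T ∈ Fintype.piFinset P, ∏ j, overlapWeight d q k #(T j ∩ S j) ≤
      (1 + overlapSum d q k #W) ^ d := by
    rw [← prod_univ_sum P fun j T => overlapWeight d q k #(T ∩ S j)]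
    calc _ ≤ ∏ _j : Fin d, (1 + overlapSum d q k #W) :=
          prod_le_prod (fun j _ => sum_nonneg fun _ _ => overlapWeight_nonneg _ _ _ _)
            fun j _ => sum_overlapWeight_le (hS' j)
      _ = _ := by simp
  have h3 := add_sum_erase _ (fun T : Fin d → Finset (Fin n) =>
    ∏ j, overlapWeight d q k #(T j ∩ S j)) hSP
  have h4 : ∏ j, overlapWeight d q k #(S j ∩ S j) = 1 :=
    prod_eq_one fun j _ => by
      rw [inter_self, (mem_powersetCard.1 (hS' j)).2, overlapWeight_self]
  simp only [h4] at h3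
  linarith

open Finset in
/-- The number of arrays that are not `k`-universal is controlled by the expected number of copies
of a fixed pattern inside `W ^ d`. -/
theorem card_not_isUniversal_le_exp {d q k n : ℕ} (hd : 2 ≤ d) (hq : 1 ≤ q) (hk : 0 < k)
    (W : Finset (Fin n)) (hW : (1 + overlapSum d q k #W) ^ d ≤ 5 / 4)
    [DecidablePred fun A : DArray d q fun _ => n => ¬ A.IsUniversal k] :
    (#{A : DArray d q fun _ => n | ¬ A.IsUniversal k} : ℝ) ≤
      (q : ℝ) ^ k ^ d * Real.exp (-(((#W).choose k : ℝ) ^ d / (q : ℝ) ^ k ^ d) / 2) *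
        (q : ℝ) ^ n ^ d := by
  rw [mul_assoc]
  refine card_not_isUniversal_le hq W _ fun v => ?_
  have : Nonempty (Fin q) := ⟨⟨0, hq⟩⟩
  refine (card_avoiding_le_exp _ v _ fun S hS => ?_).trans_eq ?_
  · rw [Fintype.card_fin]
    exact (sum_correlation_le hd hq hk W S hS).trans (by linarith)
  · rw [Fintype.card_fin]
    congr 4
    · rw [sum_congr rfl fun T hT => show ((q : ℝ) ^ #(Fintype.piFinset T))⁻¹ =
        ((q : ℝ) ^ k ^ d)⁻¹ from ?_]
      · rw [sum_const, nsmul_eq_mul, Fintype.card_piFinset]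
        simp [card_powersetCard, div_eq_mul_inv]
      · rw [Fintype.card_piFinset, prod_congr rfl fun j _ =>
          (mem_powersetCard.1 (Fintype.mem_piFinset.1 hT j)).2]
        simp
    · simp

/-! ### Estimates for the overlap sum and the expected number of copies. -/

theorem factorial_mul_exp_le {k : ℕ} (hk : 0 < k) :
    (k.factorial : ℝ) * Real.exp k ≤ Real.exp 1 * k * (k : ℝ) ^ k := by
  induction k, hk using Nat.le_induction with
  | base => simp
  | succ k hk ih =>
    have hk0 : (0 : ℝ) < k := by exact_mod_cast hk
    have h1 : Real.exp 1 * (k : ℝ) ^ (k + 1) ≤ ((k : ℝ) + 1) ^ (k + 1) := by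
      have h2 : Real.exp (1 / ((k : ℝ) + 1)) ≤ ((k : ℝ) + 1) / k := by
        have h3 := Real.one_sub_le_exp_neg (1 / ((k : ℝ) + 1))
        have h4 : 1 - 1 / ((k : ℝ) + 1) = k / (k + 1) := by field_simp; ring
        rw [h4, Real.exp_neg] at h3
        have h5 := inv_anti₀ (by positivity) h3
        rwa [inv_inv, inv_div] at h5
      have h6 := pow_le_pow_left₀ (Real.exp_pos _).le h2 (k + 1)
      rw [← Real.exp_nat_mul, div_pow, le_div_iff₀ (by positivity)] at h6
      have h7 : ((k + 1 : ℕ) : ℝ) * (1 / ((k : ℝ) + 1)) = 1 := by push_cast; field_simp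
      rwa [h7] at h6
    rw [Nat.factorial_succ]
    push_cast
    rw [Real.exp_add]
    calc ((k : ℝ) + 1) * k.factorial * (Real.exp k * Real.exp 1)
        = ((k : ℝ) + 1) * Real.exp 1 * (k.factorial * Real.exp k) := by ring
      _ ≤ ((k : ℝ) + 1) * Real.exp 1 * (Real.exp 1 * k * (k : ℝ) ^ k) :=
          mul_le_mul_of_nonneg_left ih (by positivity)
      _ = Real.exp 1 * ((k : ℝ) + 1) * (Real.exp 1 * (k : ℝ) ^ (k + 1)) := by ring
      _ ≤ _ := mul_le_mul_of_nonneg_left h1 (by positivity)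

theorem half_le_pow_div {d k : ℕ} (hd : 2 ≤ d) (hk : 2 ≤ k) :
    (k : ℝ) / 2 ≤ (k : ℝ) ^ (d - 1) / d := by
  obtain ⟨e, rfl⟩ : ∃ e, d = e + 2 := ⟨d - 2, by omega⟩
  have h1 : e + 2 ≤ 2 * k ^ e :=
    calc e + 2 ≤ 2 * 2 ^ e := by
          have : e + 1 ≤ 2 ^ e := Nat.lt_two_pow_self
          omega
      _ ≤ _ := Nat.mul_le_mul_left _ (Nat.pow_le_pow_left hk e)
  have h2 : ((e + 2 : ℕ) : ℝ) ≤ 2 * (k : ℝ) ^ e := by exact_mod_cast h1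
  rw [show e + 2 - 1 = e + 1 from rfl, div_le_div_iff₀ two_pos (by positivity), pow_succ]
  have : (0 : ℝ) ≤ k := Nat.cast_nonneg _
  nlinarith

/-- With b = k - a and κ = k^(d-1)/d, k² - a² = kb + ab splits the weight into q^(-κb), cancelling
the growth of the binomial, and q^(-κab/k), at most 2^(-ab/2). -/
theorem choose_mul_overlapWeight_le {d q k N a : ℕ} (hd : 2 ≤ d) (hq : 2 ≤ q) (hk : 2 ≤ k)
    (ha : a ≤ k) {c : ℝ}
    (hN : (N : ℝ) ≤ c * ((k : ℝ) / Real.exp 1) * (q : ℝ) ^ ((k : ℝ) ^ (d - 1) / (d : ℝ))) :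
    ((N - k).choose (k - a) : ℝ) * overlapWeight d q k a ≤
      (c * (k / Real.exp 1)) ^ (k - a) / (k - a).factorial *
        (2 : ℝ) ^ (-((a : ℝ) * (k - a : ℕ) / 2)) := by
  have hκ := half_le_pow_div hd hk
  set κ : ℝ := (k : ℝ) ^ (d - 1) / d with hκd
  have hk0 : (0 : ℝ) < k := by exact_mod_cast (by omega : 0 < k)
  have hq2 : (2 : ℝ) ≤ q := by exact_mod_cast hq
  have hq0 : (0 : ℝ) < q := by linarith
  set b := k - a with hb
  have hab : (k : ℝ) = a + b := by exact_mod_cast (by omega : k = a + b)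
  have hQ : (0 : ℝ) < (q : ℝ) ^ κ := by positivity
  have h1 : overlapWeight d q k a = (((q : ℝ) ^ κ) ^ b)⁻¹ * (q : ℝ) ^ (-(κ / k * (a * b))) := by
    unfold overlapWeight
    rw [← Real.rpow_natCast _ b, ← Real.rpow_mul hq0.le, ← Real.rpow_neg hq0.le,
      ← Real.rpow_add hq0]
    congr 1
    have hb' : (b : ℝ) = k - a := by linarith
    rw [hb', ← hκd]
    field_simp
    ring
  have h2 : (q : ℝ) ^ (-(κ / k * (a * b))) ≤ (2 : ℝ) ^ (-((a : ℝ) * b / 2)) := by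
    have h3 : (1 : ℝ) / 2 ≤ κ / k := by
      rw [le_div_iff₀ hk0]
      linarith
    have h4 : (0 : ℝ) ≤ a * b := by positivity
    calc (q : ℝ) ^ (-(κ / k * (a * b))) ≤ (q : ℝ) ^ (-((a : ℝ) * b / 2)) :=
          Real.rpow_le_rpow_of_exponent_le (by linarith) (by nlinarith)
      _ ≤ _ := Real.rpow_le_rpow_of_nonpos two_pos hq2 (by linarith)
  have h5 : ((N - k).choose b : ℝ) ≤
      (c * (k / Real.exp 1)) ^ b * ((q : ℝ) ^ κ) ^ b / b.factorial := by
    refine (Nat.choose_le_pow_div b (N - k)).trans ?_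
    rw [← mul_pow]
    gcongr
    refine le_trans ?_ hN
    exact_mod_cast Nat.sub_le _ _
  rw [h1]
  calc _ ≤ (c * (k / Real.exp 1)) ^ b * ((q : ℝ) ^ κ) ^ b / b.factorial *
        ((((q : ℝ) ^ κ) ^ b)⁻¹ * (2 : ℝ) ^ (-((a : ℝ) * b / 2))) := by
        refine mul_le_mul h5 (mul_le_mul_of_nonneg_left h2 (by positivity)) (by positivity) ?_
        exact (Nat.cast_nonneg _).trans h5
    _ = _ := by field_simp

theorem overlapSum_le {d q k N : ℕ} (hd : 2 ≤ d) (hq : 2 ≤ q) (hk : 2 ≤ k) {c ρ : ℝ}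
    (hN : (N : ℝ) ≤ c * ((k : ℝ) / Real.exp 1) * (q : ℝ) ^ ((k : ℝ) ^ (d - 1) / (d : ℝ)))
    (hρ : ρ = (2 : ℝ) ^ (-((k : ℝ) / 8))) (hc1 : 1 ≤ c) (hce : c ≤ 2)
    (hcρ : c ^ k ≤ ρ⁻¹) (hρ1 : (k : ℝ) ^ 2 * Real.exp 1 * ρ ≤ 1) :
    overlapSum d q k N ≤ k * ((k : ℝ) ^ 2 * Real.exp 1 * ρ) := by
  have hk1 : (1 : ℝ) ≤ k := by exact_mod_cast (by omega : 1 ≤ k)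
  have hk0 : (0 : ℝ) < k := by linarith
  have hρ0 : 0 < ρ := by rw [hρ]; positivity
  have he0 : (0 : ℝ) < Real.exp 1 := Real.exp_pos 1
  have he2 : (2 : ℝ) ≤ Real.exp 1 := by
    have := Real.add_one_le_exp (1 : ℝ)
    linarith
  have hρle : ρ ≤ 1 := by
    rw [hρ]
    exact Real.rpow_le_one_of_one_le_of_nonpos one_le_two (by linarith)
  have hρpow : ∀ m : ℕ, ρ ^ (2 * m) = (2 : ℝ) ^ (-((m : ℝ) * k / 4)) := by
    intro m
    rw [hρ, ← Real.rpow_natCast, ← Real.rpow_mul two_pos.le]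
    congr 1
    push_cast
    ring
  unfold overlapSum
  have hterm : ∀ a ∈ Finset.Ioo 0 k,
      ((k.choose a * (N - k).choose (k - a) : ℕ) : ℝ) * overlapWeight d q k a ≤
        (k : ℝ) ^ 2 * Real.exp 1 * ρ := by
    intro a ha
    rw [Finset.mem_Ioo] at ha
    have h1 := choose_mul_overlapWeight_le hd hq hk ha.2.le hN
    push_cast
    rw [mul_assoc]
    refine (mul_le_mul_of_nonneg_left h1 (Nat.cast_nonneg _)).trans ?_
    obtain ⟨b, hb⟩ : ∃ b, k = a + b := ⟨k - a, by omega⟩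
    have hba : k - a = b := by omega
    have hab : (k : ℝ) = a + b := by exact_mod_cast hb
    have ha1 : (1 : ℝ) ≤ a := by exact_mod_cast ha.1
    have hb1 : (1 : ℝ) ≤ b := by exact_mod_cast (by omega : 1 ≤ b)
    rw [hba]
    -- For small `a`, the decay ρ^(2a) pays for both k^a e^a and the loss c^b ≤ ρ⁻¹. For large `a`,
    -- both combinatorial factors are at most k^b, against ρ^b.
    rcases le_total (2 * a) k with h | h
    · have h2 : (2 : ℝ) ^ (-((a : ℝ) * b / 2)) ≤ ρ ^ (2 * a) := by
        rw [hρpow]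
        refine Real.rpow_le_rpow_of_exponent_le one_le_two ?_
        have : (2 : ℝ) * a ≤ k := by exact_mod_cast h
        nlinarith
      have h3 : (k.choose a : ℝ) ≤ (k : ℝ) ^ a := by exact_mod_cast Nat.choose_le_pow k a
      have h4 : (c * (k / Real.exp 1)) ^ b / b.factorial ≤ ρ⁻¹ * Real.exp 1 ^ a := by
        have h5 := Real.pow_div_factorial_le_exp (k : ℝ) hk0.le b
        have h6 : c ^ b ≤ ρ⁻¹ := (pow_le_pow_right₀ hc1 (by omega)).trans hcρ
        have h7 : Real.exp k = Real.exp 1 ^ a * Real.exp 1 ^ b := by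
          rw [← pow_add, ← hb, ← Real.exp_nat_mul, mul_one]
        calc (c * (k / Real.exp 1)) ^ b / b.factorial
            = c ^ b * ((k : ℝ) ^ b / b.factorial * (Real.exp 1 ^ b)⁻¹) := by
              rw [mul_pow, div_pow]
              ring
          _ ≤ ρ⁻¹ * (Real.exp k * (Real.exp 1 ^ b)⁻¹) := by gcongr
          _ = _ := by
              rw [h7]
              field_simp
      have h8 : (k : ℝ) * Real.exp 1 * ρ ≤ (k : ℝ) ^ 2 * Real.exp 1 * ρ := by
        gcongr
        nlinarith
      have h9 : ρ ^ a * ρ⁻¹ ≤ 1 := by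
        rw [← div_eq_mul_inv, div_le_one hρ0]
        exact pow_le_of_le_one hρ0.le hρle (by omega)
      calc _ ≤ (k : ℝ) ^ a * (ρ⁻¹ * Real.exp 1 ^ a * ρ ^ (2 * a)) := by gcongr
        _ = (k * Real.exp 1 * ρ) ^ a * (ρ ^ a * ρ⁻¹) := by
            rw [two_mul, pow_add, mul_pow, mul_pow]
            ring
        _ ≤ (k * Real.exp 1 * ρ) ^ a := mul_le_of_le_one_right (by positivity) h9
        _ ≤ k * Real.exp 1 * ρ :=
            pow_le_of_le_one (by positivity) (h8.trans hρ1) (by omega)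
        _ ≤ _ := h8
    · have h2 : (2 : ℝ) ^ (-((a : ℝ) * b / 2)) ≤ ρ ^ b := by
        refine le_trans ?_ (pow_le_pow_of_le_one hρ0.le hρle (by omega : b ≤ 2 * b))
        rw [hρpow]
        refine Real.rpow_le_rpow_of_exponent_le one_le_two ?_
        have : (k : ℝ) ≤ 2 * a := by exact_mod_cast h
        nlinarith
      have h3 : (k.choose a : ℝ) ≤ (k : ℝ) ^ b := by
        rw [← Nat.choose_symm ha.2.le, hba]
        exact_mod_cast Nat.choose_le_pow k b
      have h4 : (c * (k / Real.exp 1)) ^ b / b.factorial ≤ (k : ℝ) ^ b := by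
        have h5 : c * (k / Real.exp 1) ≤ k := by
          rw [mul_div_assoc', div_le_iff₀ he0]
          nlinarith
        have h6 : (1 : ℝ) ≤ b.factorial := by exact_mod_cast Nat.factorial_pos b
        refine (div_le_self (by positivity) h6).trans ?_
        gcongr
      have h8 : (k : ℝ) ^ 2 * ρ ≤ (k : ℝ) ^ 2 * Real.exp 1 * ρ := by
        gcongr
        nlinarith [sq_nonneg (k : ℝ)]
      calc _ ≤ (k : ℝ) ^ b * ((k : ℝ) ^ b * ρ ^ b) := by gcongr
        _ = ((k : ℝ) ^ 2 * ρ) ^ b := by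
            rw [mul_pow, ← pow_mul, mul_comm 2 b, pow_mul]
            ring
        _ ≤ (k : ℝ) ^ 2 * ρ := pow_le_of_le_one (by positivity) (h8.trans hρ1) (by omega)
        _ ≤ _ := h8
  refine (Finset.sum_le_card_nsmul _ _ _ hterm).trans ?_
  rw [nsmul_eq_mul, Nat.card_Ioo]
  refine mul_le_mul_of_nonneg_right ?_ (by positivity)
  exact_mod_cast (by omega : k - 0 - 1 ≤ k)

theorem le_choose_pow_div {d q k N : ℕ} (hd : 2 ≤ d) (hq : 2 ≤ q) (hk : 2 ≤ k) {c : ℝ}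
    (hc : 0 ≤ c)
    (hN : c * ((k : ℝ) / Real.exp 1) * (q : ℝ) ^ ((k : ℝ) ^ (d - 1) / (d : ℝ)) + k ≤ N + 1) :
    (c ^ k / (Real.exp 1 * k)) ^ d ≤ (N.choose k : ℝ) ^ d / (q : ℝ) ^ k ^ d := by
  have hk0 : (0 : ℝ) < k := by exact_mod_cast (by omega : 0 < k)
  have hq0 : (0 : ℝ) < q := by exact_mod_cast (by omega : 0 < q)
  have hd0 : (0 : ℝ) < d := by exact_mod_cast (by omega : 0 < d)
  have he0 : (0 : ℝ) < Real.exp 1 := Real.exp_pos 1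
  set Q : ℝ := (q : ℝ) ^ ((k : ℝ) ^ (d - 1) / (d : ℝ)) with hQ
  have hQ0 : 0 < Q := by positivity
  have hQd : (Q ^ k) ^ d = (q : ℝ) ^ k ^ d := by
    rw [← pow_mul, hQ, ← Real.rpow_natCast _ (k * d), ← Real.rpow_mul hq0.le,
      ← Real.rpow_natCast _ (k ^ d)]
    congr 1
    obtain ⟨e, rfl⟩ : ∃ e, d = e + 1 := ⟨d - 1, by omega⟩
    push_cast
    field_simp
    rw [pow_succ]
  rw [← hQd, ← div_pow]
  refine pow_le_pow_left₀ (by positivity) ?_ d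
  rw [le_div_iff₀ (by positivity)]
  refine le_trans ?_ (Nat.pow_le_choose k N)
  have hfac := factorial_mul_exp_le (k := k) (by omega)
  have h1 : c * (k / Real.exp 1) * Q ≤ ((N + 1 - k : ℕ) : ℝ) := by
    have : (N : ℝ) + 1 - k ≤ ((N + 1 - k : ℕ) : ℝ) := by
      rw [sub_le_iff_le_add]
      exact_mod_cast (by omega : N + 1 ≤ N + 1 - k + k)
    linarith
  have h2 : c ^ k / (Real.exp 1 * k) * Q ^ k ≤ (c * (k / Real.exp 1) * Q) ^ k / k.factorial := by
    rw [le_div_iff₀ (by positivity), mul_pow, mul_pow, div_pow, ← Real.exp_nat_mul, mul_one]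
    have h3 : (k.factorial : ℝ) / (Real.exp 1 * k) ≤ (k : ℝ) ^ k / Real.exp k := by
      rw [div_le_div_iff₀ (by positivity) (Real.exp_pos _)]
      linarith
    calc _ = c ^ k * Q ^ k * ((k.factorial : ℝ) / (Real.exp 1 * k)) := by ring
      _ ≤ c ^ k * Q ^ k * ((k : ℝ) ^ k / Real.exp k) :=
          mul_le_mul_of_nonneg_left h3 (by positivity)
      _ = _ := by ring
  refine h2.trans ?_
  gcongr

/-! ### Passage to the limit. -/

theorem one_sub_le_uniformOn {Ω : Type*} [Fintype Ω] [Nonempty Ω] [MeasurableSpace Ω]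
    [MeasurableSingletonClass Ω] (p : Ω → Prop) [DecidablePred fun ω => ¬ p ω] {u : ℝ}
    (h : ((Finset.univ.filter fun ω => ¬ p ω).card : ℝ) ≤ u * Fintype.card Ω) :
    1 - ENNReal.ofReal u ≤ ProbabilityTheory.uniformOn (Set.univ : Set Ω) {ω | p ω} := by
  have hmeas : MeasurableSet {ω | ¬ p ω} := (Set.toFinite _).measurableSet
  have hcompl : ({ω | p ω} : Set Ω) = {ω | ¬ p ω}ᶜ := by
    ext
    simp
  rw [hcompl, MeasureTheory.prob_compl_eq_one_sub hmeas]
  refine tsub_le_tsub_left ?_ 1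
  have hset : ({ω | ¬ p ω} : Set Ω) = ((Finset.univ.filter fun ω => ¬ p ω : Finset Ω) : Set Ω) := by
    ext
    simp
  rw [ProbabilityTheory.uniformOn_univ, hset, MeasureTheory.Measure.count_apply_finset]
  have hc : (0 : ℝ) < Fintype.card Ω := by exact_mod_cast Fintype.card_pos
  rw [← ENNReal.ofReal_natCast, ← ENNReal.ofReal_natCast (Fintype.card Ω),
    ← ENNReal.ofReal_div_of_pos hc]
  exact ENNReal.ofReal_le_ofReal ((div_le_iff₀ hc).2 h)

open Filter Topology in
theorem tendsto_cube_mul_two_rpow :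
    Tendsto (fun k : ℕ => (k : ℝ) * ((k : ℝ) ^ 2 * Real.exp 1 * (2 : ℝ) ^ (-((k : ℝ) / 8))))
      atTop (𝓝 0) := by
  have h1 : |(2 : ℝ) ^ (-(1 / 8 : ℝ))| < 1 := by
    rw [abs_of_pos (by positivity)]
    exact Real.rpow_lt_one_of_one_lt_of_neg one_lt_two (by norm_num)
  have h2 := (tendsto_pow_const_mul_const_pow_of_abs_lt_one 3 h1).const_mul (Real.exp 1)
  rw [mul_zero] at h2
  refine h2.congr fun k => ?_
  rw [← Real.rpow_natCast _ k, ← Real.rpow_mul two_pos.le,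
    show -(1 / 8 : ℝ) * k = -((k : ℝ) / 8) by ring]
  ring

open Filter Topology in
theorem eventually_overlapSum_le {d q : ℕ} (hd : 2 ≤ d) (hq : 2 ≤ q) {c : ℝ} (hc1 : 1 ≤ c)
    (hc8 : c ^ 8 ≤ 2) (N : ℕ → ℕ)
    (hN : ∀ k, (N k : ℝ) ≤
      c * ((k : ℝ) / Real.exp 1) * (q : ℝ) ^ ((k : ℝ) ^ (d - 1) / (d : ℝ))) :
    ∀ᶠ k in atTop, (1 + overlapSum d q k (N k)) ^ d ≤ 5 / 4 := by
  have hlim := tendsto_cube_mul_two_rpow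
  have hlim' := (hlim.const_add 1).pow d
  rw [add_zero, one_pow] at hlim'
  filter_upwards [hlim'.eventually_le_const (by norm_num : (1 : ℝ) < 5 / 4),
    hlim.eventually_le_const one_pos, eventually_ge_atTop 2] with k h1 h2 hk
  have hk1 : (1 : ℝ) ≤ k := by exact_mod_cast (by omega : 1 ≤ k)
  refine le_trans (pow_le_pow_left₀ ?_ (add_le_add_right
    (overlapSum_le hd hq hk (hN k) rfl hc1 ?_ ?_ ?_) 1) d) h1
  · have := overlapSum_nonneg d q k (N k)
    linarith
  · exact (le_self_pow₀ hc1 (by norm_num)).trans hc8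
  -- The bound c^8 ≤ 2 is what gives c^k ≤ 2^(k/8).
  · rw [← Real.rpow_neg two_pos.le, neg_neg]
    calc c ^ k = (c ^ 8) ^ ((k : ℝ) / 8) := by
          rw [← Real.rpow_natCast, ← Real.rpow_natCast, ← Real.rpow_mul (by linarith)]
          congr 1
          push_cast
          ring
      _ ≤ _ := Real.rpow_le_rpow (by positivity) hc8 (by positivity)
  · exact le_trans (le_mul_of_one_le_left (by positivity) hk1) h2

open Filter Topology in
theorem eventually_pow_mul_exp_le {d q : ℕ} (hq : 2 ≤ q) (hd : d ≠ 0) {c : ℝ} (hc : 1 < c) :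
    ∀ᶠ k : ℕ in atTop, ∀ m : ℝ, (c ^ k / (Real.exp 1 * k)) ^ d ≤ m →
      (q : ℝ) ^ k ^ d * Real.exp (-m / 2) ≤ Real.exp (-(k : ℝ)) := by
  have hq1 : (1 : ℝ) ≤ q := by exact_mod_cast (by omega : 1 ≤ q)
  have hL : 0 ≤ Real.log q := Real.log_nonneg hq1
  have hlim := tendsto_pow_const_div_const_pow_of_one_lt (d + 1) hc
  filter_upwards [hlim.eventually_le_const
    (show (0 : ℝ) < 1 / (2 * Real.exp 1 * (Real.log q + 1)) by positivity),
    eventually_ge_atTop 1] with k hk hk1 m hm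
  have hk1' : (1 : ℝ) ≤ k := by exact_mod_cast hk1
  have hk0 : (0 : ℝ) < k := by linarith
  have hc0 : 0 < c := by linarith
  set Y := c ^ k / (Real.exp 1 * k) with hY
  have hkd : (k : ℝ) ≤ (k : ℝ) ^ d := le_self_pow₀ hk1' hd
  -- Half of this cancels q^(k^d) and leaves exp(-k^d).
  have h1 : 2 * ((k : ℝ) ^ d * (Real.log q + 1)) ≤ Y := by
    rw [hY, le_div_iff₀ (by positivity)]
    rw [div_le_div_iff₀ (by positivity) (by positivity), pow_succ] at hk
    linarith
  have h2 : 1 ≤ Y := by nlinarith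
  have h3 : Y ≤ m := (le_self_pow₀ h2 hd).trans hm
  have h4 : (q : ℝ) ^ k ^ d = Real.exp ((k : ℝ) ^ d * Real.log q) := by
    rw [← Real.rpow_natCast, Real.rpow_def_of_pos (by linarith)]
    push_cast
    rw [mul_comm]
  rw [h4, ← Real.exp_add]
  refine Real.exp_le_exp.2 ?_
  nlinarith

open Filter Topology in
/-- The order `(1 + ε) (k / e) q ^ (k ^ (d - 1) / d)` is a real number, so the order `n k` is any
rounding of it to a natural number. -/
theorem theorem3 (d q : ℕ) (hd : 2 ≤ d) (hq : 2 ≤ q) (ε : ℝ) (hε : 0 < ε) (n : ℕ → ℕ)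
    (hn : ∀ k : ℕ, |(n k : ℝ) -
      (1 + ε) * ((k : ℝ) / Real.exp 1) * (q : ℝ) ^ ((k : ℝ) ^ (d - 1) / (d : ℝ))| < 1) :
    Filter.Tendsto
      (fun k : ℕ => ProbabilityTheory.uniformOn (Set.univ : Set (DArray d q fun _ => n k))
        {A | A.IsUniversal k})
      Filter.atTop (nhds 1) := by
  classical
  have : Nonempty (Fin q) := ⟨⟨0, by omega⟩⟩
  have hq2 : (2 : ℝ) ≤ q := by exact_mod_cast hq
  have he0 : (0 : ℝ) < Real.exp 1 := Real.exp_pos 1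
  set X : ℕ → ℝ := fun k => (k : ℝ) / Real.exp 1 * (q : ℝ) ^ ((k : ℝ) ^ (d - 1) / (d : ℝ)) with hX
  have hX0 : ∀ k, 0 ≤ X k := fun k => by positivity
  -- The cap 1/16 keeps overlaps negligible even for large `ε`; δ ≤ ε/2 lets `W` fit despite
  -- rounding.
  set δ : ℝ := min (ε / 2) (1 / 16) with hδ
  have hδ0 : 0 < δ := lt_min (by linarith) (by norm_num)
  have hδε : δ ≤ ε / 2 := min_le_left _ _
  have hδ16 : δ ≤ 1 / 16 := min_le_right _ _
  set N : ℕ → ℕ := fun k => ⌊(1 + δ) * X k⌋₊ with hNdef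
  have hN : ∀ k, (N k : ℝ) ≤ (1 + δ) * X k := fun k =>
    Nat.floor_le (mul_nonneg (by linarith) (hX0 k))
  have hN' : ∀ k, (1 + δ) * X k < N k + 1 := fun k => Nat.lt_floor_add_one _
  have hXk : ∀ k : ℕ, 2 ≤ k → (k : ℝ) * (k / 2 / Real.exp 1) ≤ X k := by
    intro k hk
    have h1 := half_le_pow_div hd hk
    have hk2 : (2 : ℝ) ≤ k := by exact_mod_cast hk
    set κ := (k : ℝ) ^ (d - 1) / (d : ℝ) with hκ
    have h2 := one_add_mul_self_le_rpow_one_add (s := 1) (by norm_num) (p := κ) (by linarith)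
    have h3 : ((1 : ℝ) + 1) ^ κ ≤ (q : ℝ) ^ κ :=
      Real.rpow_le_rpow (by norm_num) (by linarith) (by linarith)
    have h4 : (k : ℝ) / 2 ≤ (q : ℝ) ^ κ := by linarith
    calc (k : ℝ) * (k / 2 / Real.exp 1) = k / Real.exp 1 * (k / 2) := by ring
      _ ≤ _ := mul_le_mul_of_nonneg_left h4 (by positivity)
  have hN5 := eventually_overlapSum_le hd hq (c := 1 + δ) (by linarith) (by
    calc (1 + δ) ^ 8 ≤ (1 + 1 / 16) ^ 8 := pow_le_pow_left₀ (by linarith) (by linarith) 8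
      _ ≤ 2 := by norm_num) N (fun k => by rw [mul_assoc]; exact hN k)
  -- The other δ/2 absorbs the `k` lost in bounding the binomial below by (N + 1 - k)^k / k!.
  have hexp := eventually_pow_mul_exp_le (d := d) hq (by omega)
    (show (1 : ℝ) < 1 + δ / 2 by linarith)
  have hbig : ∀ᶠ k : ℕ in atTop, 2 * Real.exp 1 * (2 / δ) ≤ k :=
    tendsto_natCast_atTop_atTop.eventually_ge_atTop _
  have hlow : ∀ᶠ k : ℕ in atTop, 1 - ENNReal.ofReal (Real.exp (-(k : ℝ))) ≤
      ProbabilityTheory.uniformOn (Set.univ : Set (DArray d q fun _ => n k))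
        {A | A.IsUniversal k} := by
    filter_upwards [hN5, hexp, hbig, eventually_ge_atTop 2] with k h5 hexp hbig hk
    have hk2 : (2 : ℝ) ≤ k := by exact_mod_cast hk
    have hkX : (k : ℝ) ≤ δ / 2 * X k := by
      have h1 : 2 / δ ≤ k / 2 / Real.exp 1 := by
        rw [le_div_iff₀ he0]
        linarith
      have h2 : (k : ℝ) * (2 / δ) ≤ X k :=
        (mul_le_mul_of_nonneg_left h1 (by linarith)).trans (hXk k hk)
      calc (k : ℝ) = δ / 2 * (k * (2 / δ)) := by field_simp
        _ ≤ _ := mul_le_mul_of_nonneg_left h2 (by linarith)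
    have hNn : N k ≤ n k := by
      have h1 := (abs_lt.1 (hn k)).1
      rw [mul_assoc] at h1
      have h2 : (N k : ℝ) < n k := by
        have := hN k
        have h3 : δ * X k ≤ ε / 2 * X k := mul_le_mul_of_nonneg_right hδε (hX0 k)
        change -1 < (n k : ℝ) - (1 + ε) * X k at h1
        nlinarith
      exact (Nat.cast_lt.1 h2).le
    obtain ⟨W, -, hW⟩ := Finset.exists_subset_card_eq
      (show N k ≤ (Finset.univ : Finset (Fin (n k))).card by simpa using hNn)
    refine one_sub_le_uniformOn _ ?_
    have hcount := card_not_isUniversal_le_exp hd (by omega : 1 ≤ q) (by omega : 0 < k) W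
      (by rw [hW]; exact h5)
    rw [hW] at hcount
    have hcard : (Fintype.card (DArray d q fun _ => n k) : ℝ) = (q : ℝ) ^ n k ^ d := by
      simp
    rw [hcard]
    refine hcount.trans (mul_le_mul_of_nonneg_right (hexp _ ?_) (by positivity))
    refine le_choose_pow_div hd hq hk (by linarith) ?_
    have := hN' k
    rw [mul_assoc]
    change (1 + δ / 2) * X k + k ≤ N k + 1
    linarith
  have hlim : Tendsto (fun k : ℕ => 1 - ENNReal.ofReal (Real.exp (-(k : ℝ)))) atTop (𝓝 1) := by
    have h1 : Tendsto (fun k : ℕ => ENNReal.ofReal (Real.exp (-(k : ℝ)))) atTop (𝓝 0) := by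
      rw [← ENNReal.ofReal_zero]
      exact ENNReal.tendsto_ofReal
        (Real.tendsto_exp_neg_atTop_nhds_zero.comp tendsto_natCast_atTop_atTop)
    have h2 := ENNReal.Tendsto.sub (tendsto_const_nhds (x := (1 : ENNReal)) (f := atTop)) h1
      (Or.inl ENNReal.one_ne_top)
    rwa [tsub_zero] at h2
  exact tendsto_of_tendsto_of_tendsto_of_le_of_le' hlim tendsto_const_nhds hlow
    (Eventually.of_forall fun k => MeasureTheory.prob_le_one)
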